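/- Let $X=I_1\times\dots\times I_n\subset\mathbb{R}^n$ be a product of $n$ intervals (each open, closed or half-open, bounded or unbounded), and let $f:X\to\mathbb{R}^n$ be differentiable on $X$ (relative to $X$) with Jacobian matrix $Df(x)$ at $x\in X$. (If some $I_i$ is a single point, $Df(x)$ is not unique; then any fixed choice of matrices representing the derivative relative to $X$ is allowed.) Let $f^-$ be the set of all functions $f-q$ on $X$, where $q(x)=(q_1(x_1),\dots,q_n(x_n))$ with each $q_i:I_i\to\mathbb{R}$ differentiable and $q_i'>0$ on $I_i$. *DSR graphs.* For real $n\times m$ matrices $A,B$ let $G_{A,B}$ be the bipartite multigraph with S-vertices $1,\dots,n$ and R-vertices $1,\dots,m$ in which each $A_{ij}\ne0$ gives an edge between S-vertex $i$ and R-vertex $j$ with R-to-S direction, the sign of $A_{ij}$ and label $|A_{ij}|$, and each $B_{ij}\neq 0$ gives an edge between S-vertex $i$ and R-vertex $j$ with S-to-R direction and the sign of $B_{ij}$. If $A_{ij}B_{ij}>0$, these two are one single edge having both directions and label $|A_{ij}|$; if $A_{ij}B_{ij}<0$, they are two distinct edges. Edges with only S-to-R direction have label $\infty$. Let $$\mathcal{G}_{f(x)}=\{G_{A,B^T}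 : m\in\mathbb{N},\ A\in\mathbb{R}^{n\times m},\ B\in\mathbb{R}^{m\times n},\ AB=-Df(x)\}.$$ A cycle $C$ in such a graph is a directed cycle (each edge being traversed in a direction it has) without repeated vertices or edges; two distinct edges between the same pair of vertices, one traversed from S to R and the other from R to S, form a cycle of length $2$. With $|C|$ the number of edges and $\mathrm{sign}(C)$ the product of the signs of the edges, $C$ is an e-cycle if $(-1)^{|C|/2}\,\mathrm{sign}(C)=1$. A graph satisfies Condition ($**$) if it contains no e-cycles. For $\gamma\subset\{1,\dots,n\}$ and $\delta\subset\{1,\dots,m\}$ with $|\gamma|=|\delta|$, a term subgraph on $(\gamma,\delta)$ is a set of edges between S-vertices in $\gamma$ and R-vertices in $\delta$ such that each vertex of $\gamma$ and of $\delta$ is incident with exactly one of them. It has S-to-R (R-to-S) direction if all its edges do; edges having both directions count for both. An $n\times m$ DSR graph is *nondegenerate* if for each nonempty $\gamma\subset\{1,\dots,n\}$ there is a $\delta\subset\{1,\dots,m\}$ with $|\delta|=|\gamma|$ such that there are on $(\gamma,\delta)$ both a term subgraph with S-to-R direction and a term subgraph with R-to-S direction. It is *weakly nondegenerate* if this holds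 for $\gamma=\{1,\dots,n\}$. **Theorem.** 1. If at each $x\in X$ there is a nondegenerate graph $G\in\mathcal{G}_{f(x)}$ satisfying Condition ($**$), then every function in $f^-$ is injective on $X$, and $f$ is injective on $X$. 2. If $X$ is open and at each $x\in X$ there is a weakly nondegenerate graph $G\in\mathcal{G}_{f(x)}$ satisfying Condition ($**$), then every function in $f^-$ is injective on $X$, and $f$ is injective on $X$. -/

import Mathlib

open scoped ENNReal

/-- A rectangular subset of `ℝⁿ`: a product of `n` intervals (order-connected subsets of `ℝ`), which
may be open, closed or half-open, bounded or unbounded. -/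
def IsRectangular {n : ℕ} (X : Set (Fin n → ℝ)) : Prop :=
  ∃ I : Fin n → Set ℝ, (∀ i, (I i).OrdConnected) ∧ X = Set.univ.pi I

/-- `f` is differentiable on `X` (relative to `X`), with Jacobian matrix `Df x` at each `x ∈ X`. If
all side intervals of `X` are nondegenerate, the matrices `Df x` are determined by `f`. -/
def HasJacobianOn {n : ℕ} (f : (Fin n → ℝ) → (Fin n → ℝ))
    (Df : (Fin n → ℝ) → Matrix (Fin n) (Fin n) ℝ) (X : Set (Fin n → ℝ)) : Prop :=
  ∀ x ∈ X, HasFDerivWithinAt f (LinearMap.toContinuousLinearMap (Matrix.toLin' (Df x))) X x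

/-- The differentiable diagonal functions `q = (q₁(x₁), …, qₙ(xₙ))` on `X` with positive slope: `φ i`
is the `i`-th component, a function on the `i`-th side of `X` with positive derivative there. -/
def posDiagonal {n : ℕ} (X : Set (Fin n → ℝ)) : Set ((Fin n → ℝ) → (Fin n → ℝ)) :=
  {q | ∃ φ : Fin n → ℝ → ℝ,
    (∀ x ∈ X, ∀ i, q x i = φ i (x i)) ∧
    ∀ i, ∀ t ∈ (fun x : Fin n → ℝ => x i) '' X,
      ∃ d : ℝ, 0 < d ∧ HasDerivWithinAt (φ i) d ((fun x : Fin n → ℝ => x i) '' X) t}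

/-- The collection `f⁻` of all functions `f - q` with `q` diagonal of positive slope on `X`. -/
def fMinus {n : ℕ} (X : Set (Fin n → ℝ)) (f : (Fin n → ℝ) → (Fin n → ℝ)) :
    Set ((Fin n → ℝ) → (Fin n → ℝ)) :=
  {g | ∃ q ∈ posDiagonal X, g = f - q}

/-- A possible edge of an `n × m` DSR graph: it joins S-vertex `s` and R-vertex `r` and has a sign.
Two edges of a DSR graph between the same pair of vertices have different signs, so that an edge is
determined by these data. -/
@[ext]
structure DSREdge (n m : ℕ) where
  s : Fin n
  r : Fin m
  sign : ℤˣ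

/-- An `n × m` DSR graph: the edges with S-to-R direction, the edges with R-to-S direction, and the
edge-labels in `(0, ∞]`. An edge with both directions is an undirected edge. The label of an edge
which is not present is irrelevant. -/
structure DSRGraph (n m : ℕ) where
  StoR : DSREdge n m → Prop
  RtoS : DSREdge n m → Prop
  label : DSREdge n m → ℝ≥0∞
  label_pos : ∀ e, 0 < label e

open Classical in
/-- The DSR graph `G_{A,B}` of a pair of `n × m` matrices: `A i j ≠ 0` gives an edge with R-to-S
direction, the sign of `A i j` and label `|A i j|`; `B i j ≠ 0` gives an edge with S-to-R direction
and the sign of `B i j`; the two edges coincide when the signs agree. An edge with only S-to-R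
direction has label `∞`. -/
noncomputable def dsrGraph {n m : ℕ} (A B : Matrix (Fin n) (Fin m) ℝ) : DSRGraph n m where
  StoR e := 0 < ((e.sign : ℤ) : ℝ) * B e.s e.r
  RtoS e := 0 < ((e.sign : ℤ) : ℝ) * A e.s e.r
  label e := if 0 < ((e.sign : ℤ) : ℝ) * A e.s e.r then ENNReal.ofReal |A e.s e.r| else ⊤
  label_pos e := by
    split_ifs with h
    · refine ENNReal.ofReal_pos.2 (abs_pos.2 fun h0 => ?_)
      simp [h0] at h
    · exact ENNReal.zero_lt_top

/-- The `n × m` DSR graphs associated with a function at a point where its Jacobian is `J`: all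
`G_{A,Bᵀ}` with `A B = -J`, where `A` is `n × m` and `B` is `m × n`. -/
def dsrGraphsOf {n : ℕ} (J : Matrix (Fin n) (Fin n) ℝ) (m : ℕ) : Set (DSRGraph n m) :=
  {G | ∃ (A : Matrix (Fin n) (Fin m) ℝ) (B : Matrix (Fin m) (Fin n) ℝ),
    A * B = -J ∧ G = dsrGraph A B.transpose}

namespace DSRGraph

variable {n m : ℕ}

/-- The edge `e` is present in `G`. -/
def HasEdge (G : DSRGraph n m) (e : DSREdge n m) : Prop :=
  G.StoR e ∨ G.RtoS e

/-- A cycle of length `2 (h + 1)` in `G`, with an orientation and written from an S-vertex: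
`out 0, back 0, out 1, back 1, …, out h, back h`. The edge `out k` is traversed from S to R and
`back k` from R to S; addition in `Fin (h + 1)` is cyclic. No vertex and no edge is repeated; in
particular, a cycle of length two consists of two different edges between the same two vertices. -/
structure Cycle (G : DSRGraph n m) where
  h : ℕ
  out : Fin (h + 1) → DSREdge n m
  back : Fin (h + 1) → DSREdge n m
  out_dir : ∀ k, G.StoR (out k)
  back_dir : ∀ k, G.RtoS (back k)
  adj_r : ∀ k, (back k).r = (out k).r
  adj_s : ∀ k, (back k).s = (out (k + 1)).s
  s_injective : Function.Injective fun k => (out k).s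
  r_injective : Function.Injective fun k => (out k).r
  edge_ne : ∀ k l, out k ≠ back l

namespace Cycle

/-- The number of edges of a cycle. -/
def length {G : DSRGraph n m} (C : G.Cycle) : ℕ := 2 * (C.h + 1)

/-- The sign of a cycle: the product of the signs of its edges. -/
def sign {G : DSRGraph n m} (C : G.Cycle) : ℤˣ :=
  (∏ k, (C.out k).sign) * ∏ k, (C.back k).sign

/-- The parity `P(C) = (-1)^{|C|/2} sign(C)`. -/
def parity {G : DSRGraph n m} (C : G.Cycle) : ℤˣ :=
  (-1) ^ (C.length / 2) * C.sign

/-- An e-cycle is a cycle which is even, i.e. has parity `1`. -/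
def IsECycle {G : DSRGraph n m} (C : G.Cycle) : Prop := C.parity = 1

end Cycle

/-- Condition (∗∗): the graph contains no e-cycles. -/
def NoECycles (G : DSRGraph n m) : Prop := ∀ C : G.Cycle, ¬ C.IsECycle

/-- `T` is the edge set of a term subgraph of `G` on the S-vertices `γ` and the R-vertices `δ`: a
square subgraph in which every vertex has exactly one edge incident on it. -/
def IsTermSubgraph (G : DSRGraph n m) (γ : Finset (Fin n)) (δ : Finset (Fin m))
    (T : Set (DSREdge n m)) : Prop :=
  γ.card = δ.card ∧
  (∀ e ∈ T, G.HasEdge e ∧ e.s ∈ γ ∧ e.r ∈ δ) ∧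
  (∀ i ∈ γ, ∃! e, e ∈ T ∧ e.s = i) ∧
  (∀ j ∈ δ, ∃! e, e ∈ T ∧ e.r = j)

/-- The square subgraph of `G` on the S-vertices `γ` and the R-vertices `δ` contains a term subgraph
with S-to-R direction and one with R-to-S direction. -/
def HasBothTerms (G : DSRGraph n m) (γ : Finset (Fin n)) (δ : Finset (Fin m)) : Prop :=
  (∃ T, G.IsTermSubgraph γ δ T ∧ ∀ e ∈ T, G.StoR e) ∧
  (∃ T, G.IsTermSubgraph γ δ T ∧ ∀ e ∈ T, G.RtoS e)

/-- `G` has an `n × n` subgraph containing a term subgraph with S-to-R direction and one with R-to-S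
direction. -/
def WeaklyNondegenerate (G : DSRGraph n m) : Prop :=
  ∃ δ : Finset (Fin m), δ.card = n ∧ G.HasBothTerms Finset.univ δ

/-- For every nonempty set `γ` of S-vertices, some square subgraph with exactly these S-vertices
contains a term subgraph with S-to-R direction and one with R-to-S direction. -/
def Nondegenerate (G : DSRGraph n m) : Prop :=
  ∀ γ : Finset (Fin n), γ.Nonempty →
    ∃ δ : Finset (Fin m), δ.card = γ.card ∧ G.HasBothTerms γ δ

end DSRGraph

/-!
The matrices `-Df x` turn out to be `P`-matrices (all principal minors positive), respectively
nonsingular `P₀`-matrices (all principal minors nonnegative), and injectivity then follows from the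
theorems of Gale and Nikaido.

*From graphs to minors.* Write `-Df x = A * B`. A principal minor of `A * B` is a sum, over
injective choices `p` of inner indices and permutations `σ`, of the terms
`sign σ * ∏ i, A (σ i) (p i) * B (p i) i`. In a nonzero term each cycle of `σ` traces a cycle
`i → p i → σ i → ⋯` of the DSR graph of `A` and `Bᵀ`, and the cycle contributes a positive factor
exactly when the graph cycle is not an e-cycle; a fixed point of `σ` contributes a negative factor
only if there is an e-cycle of length two. So without e-cycles no term is negative
(`DSRGraph.NoECycles.sign_mul_prod_nonneg`), and two term subgraphs of opposite directions on the
same vertices provide a positive term (`DSRGraph.NoECycles.det_submatrix_pos`).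

*From P-matrices to injectivity.* A `P`-matrix reverses the sign of no nonzero vector
(`Matrix.IsPMatrix.exists_mul_mulVec_pos`) and, by separation of convex sets, it moves some vector
weakly of the signs of a given `z` strictly towards these signs
(`Matrix.IsPMatrix.exists_direction`). These are a local and a descent statement for the set of
points `x` of a box where `f x - f a` reverses the signs of `x - a`: `a` is isolated in that set, and
from any other point of it one can move closer to `a` within it. Compactness leaves only `a`
(`HasJacobianOn.exists_mul_sub_pos`). This needs neither continuous derivatives nor an
open region, and works with any choice of the Jacobians.

*From P₀-matrices to injectivity.* Adding a positive diagonal matrix to a `P₀`-matrix gives a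
`P`-matrix (`Matrix.IsP0Matrix.add_diagonal`), which settles the functions `f - q`. On an open region,
if `f a = f b` with nonsingular Jacobians, a small perturbation of `-f` of this kind still takes its
value at `a` at a point near `b`: there the length of the difference has an interior minimum, which
is a zero because the perturbed Jacobian is nonsingular. This contradicts the injectivity of the
perturbation (`HasJacobianOn.injOn_of_isP0Matrix`).
-/

/-! ### P-matrices -/

/-- A `P`-matrix: all principal minors are positive. A principal submatrix is presented as
`M.submatrix e e` with `e` injective, from an arbitrary finite type, so that no enumeration of the
chosen indices is needed. -/
def Matrix.IsPMatrix {ι : Type} (M : Matrix ι ι ℝ) : Prop :=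
  ∀ (κ : Type) [Fintype κ] [DecidableEq κ] (e : κ → ι), Function.Injective e →
    0 < (M.submatrix e e).det

/-- A `P₀`-matrix: all principal minors are nonnegative. -/
def Matrix.IsP0Matrix {ι : Type} (M : Matrix ι ι ℝ) : Prop :=
  ∀ (κ : Type) [Fintype κ] [DecidableEq κ] (e : κ → ι), Function.Injective e →
    0 ≤ (M.submatrix e e).det

namespace Matrix

variable {ι : Type} {M : Matrix ι ι ℝ}

theorem IsPMatrix.isP0Matrix (hM : M.IsPMatrix) : M.IsP0Matrix :=
  fun κ _ _ e he => (hM κ e he).le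

theorem IsPMatrix.transpose (hM : M.IsPMatrix) : M.transpose.IsPMatrix := fun κ _ _ e he => by
  rw [← transpose_submatrix, det_transpose]
  exact hM κ e he

theorem IsP0Matrix.submatrix {κ : Type} (hM : M.IsP0Matrix) {e : κ → ι}
    (he : Function.Injective e) : (M.submatrix e e).IsP0Matrix := fun κ' _ _ e' he' => by
  rw [submatrix_submatrix]
  exact hM κ' _ (he.comp he')

/-- Replacing the rows of `M` outside `S` by those of a diagonal matrix leaves a block triangular
matrix. -/
theorem det_ite_diagonal [Fintype ι] [DecidableEq ι] (M : Matrix ι ι ℝ) (d : ι → ℝ)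
    (S : Finset ι) :
    (of fun i j => if i ∈ S then M i j else diagonal d i j).det =
      (M.submatrix (Subtype.val : {i // i ∈ S} → ι) Subtype.val).det *
        ∏ i : {i // i ∉ S}, d i := by
  let N : Matrix ι ι ℝ := of fun i j => if i ∈ S then M i j else diagonal d i j
  have h₁ : N.toSquareBlockProp (fun i => i ∈ S) =
      M.submatrix (Subtype.val : {i // i ∈ S} → ι) Subtype.val := by
    ext i j
    simp [N, toSquareBlockProp, toBlock_apply]
  have h₂ : N.toSquareBlockProp (fun i => i ∉ S) = diagonal fun i : {i // i ∉ S} => d i := by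
    ext i j
    simp [N, toSquareBlockProp, toBlock_apply, i.2, diagonal_apply, Subtype.ext_iff]
  have h := twoBlockTriangular_det N (fun i => i ∈ S) fun i hi j hj => by
    have hij : i ≠ j := fun h => hi (h ▸ hj)
    simp [N, hi, hij]
  rw [h₁, h₂, det_diagonal] at h
  convert h

/-- The determinant of `M` plus a diagonal matrix, expanded in the principal minors of `M`. -/
theorem det_add_diagonal [Fintype ι] [DecidableEq ι] (M : Matrix ι ι ℝ) (d : ι → ℝ) :
    (M + diagonal d).det = ∑ S : Finset ι,
      (M.submatrix (Subtype.val : {i // i ∈ S} → ι) Subtype.val).det *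
        ∏ i : {i // i ∉ S}, d i := by
  refine (detRowAlternating.map_add_univ (R := ℝ) M (diagonal d)).trans
    (Finset.sum_congr rfl fun S _ => ?_)
  rw [← det_ite_diagonal]
  refine congrArg (detRowAlternating (R := ℝ)) (funext fun i => ?_)
  by_cases hi : i ∈ S
  · refine (Finset.piecewise_eq_of_mem S (fun i => M i) _ hi).trans (funext fun j => ?_)
    simp [hi]
  · refine (Finset.piecewise_eq_of_notMem S (fun i => M i) _ hi).trans (funext fun j => ?_)
    simp [hi]

theorem IsP0Matrix.det_add_diagonal_nonneg_terms [DecidableEq ι] (hM : M.IsP0Matrix)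
    {d : ι → ℝ} (hd : ∀ i, 0 ≤ d i) (S : Finset ι) [Fintype {i // i ∉ S}] :
    0 ≤ (M.submatrix (Subtype.val : {i // i ∈ S} → ι) Subtype.val).det *
        ∏ i : {i // i ∉ S}, d i :=
  mul_nonneg (hM _ _ Subtype.val_injective) (Finset.prod_nonneg fun i _ => hd i)

theorem IsP0Matrix.prod_le_det_add_diagonal [Fintype ι] [DecidableEq ι] (hM : M.IsP0Matrix)
    {d : ι → ℝ} (hd : ∀ i, 0 ≤ d i) : ∏ i, d i ≤ (M + diagonal d).det := by
  rw [det_add_diagonal]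
  refine le_trans (le_of_eq ?_) (Finset.single_le_sum
    (fun S _ => hM.det_add_diagonal_nonneg_terms hd S) (Finset.mem_univ ∅))
  rw [det_isEmpty, one_mul]
  exact Fintype.prod_equiv (Equiv.subtypeUnivEquiv (by simp)).symm _ _ (fun _ => rfl)

theorem IsP0Matrix.det_le_det_add_diagonal [Fintype ι] [DecidableEq ι] (hM : M.IsP0Matrix)
    {d : ι → ℝ} (hd : ∀ i, 0 ≤ d i) : M.det ≤ (M + diagonal d).det := by
  rw [det_add_diagonal]
  refine le_trans (le_of_eq ?_) (Finset.single_le_sum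
    (fun S _ => hM.det_add_diagonal_nonneg_terms hd S) (Finset.mem_univ Finset.univ))
  have : IsEmpty {i : ι // i ∉ (Finset.univ : Finset ι)} := ⟨fun i => i.2 (Finset.mem_univ _)⟩
  rw [Finset.prod_of_isEmpty, mul_one]
  exact (det_submatrix_equiv_self (Equiv.subtypeUnivEquiv (by simp)) M).symm

theorem IsP0Matrix.add_diagonal [DecidableEq ι] (hM : M.IsP0Matrix) {d : ι → ℝ}
    (hd : ∀ i, 0 < d i) : (M + diagonal d).IsPMatrix := fun κ _ _ e he => by
  have h : (M + diagonal d).submatrix e e = M.submatrix e e + diagonal (d ∘ e) := by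
    rw [submatrix_add, Pi.add_apply, Pi.add_apply, submatrix_diagonal _ _ he]
  rw [h]
  exact (Finset.prod_pos fun i _ => hd (e i)).trans_le
    ((hM.submatrix he).prod_le_det_add_diagonal fun i => (hd (e i)).le)

/-- A `P`-matrix reverses the sign of no nonzero vector. On the support of `y`, weak sign reversal
means that a principal submatrix plus a nonnegative diagonal matrix kills `y`; but such a sum has
positive determinant. -/
theorem IsPMatrix.exists_mul_mulVec_pos [Fintype ι] [DecidableEq ι] (hM : M.IsPMatrix) {y : ι → ℝ}
    (hy : y ≠ 0) : ∃ i, 0 < y i * (M *ᵥ y) i := by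
  by_contra! h
  let e : {i // y i ≠ 0} → ι := Subtype.val
  have he : Function.Injective e := Subtype.val_injective
  let d : {i // y i ≠ 0} → ℝ := fun i => -(M *ᵥ y) i / y i
  have hd : ∀ i, 0 ≤ d i := fun i => by
    have : d i = -(y i * (M *ᵥ y) i) / (y i) ^ 2 := by
      have := i.2
      simp only [d]
      field_simp
    rw [this]
    have := h i
    exact div_nonneg (by linarith) (sq_nonneg _)
  have hpos := (hM _ e he).trans_le
    ((hM.isP0Matrix.submatrix he).det_le_det_add_diagonal hd)
  refine hpos.ne' (exists_mulVec_eq_zero_iff.1 ⟨y ∘ e, ?_, ?_⟩)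
  · obtain ⟨i, hi⟩ := Function.ne_iff.1 hy
    exact Function.ne_iff.2 ⟨⟨i, hi⟩, hi⟩
  · ext i
    have hs : (M.submatrix e e *ᵥ (y ∘ e)) i = (M *ᵥ y) i := by
      refine Fintype.sum_of_injective e he _ (fun j => M i j * y j) (fun j hj => ?_) fun j => rfl
      have : y j = 0 := by_contra fun h' => hj ⟨⟨j, h'⟩, rfl⟩
      simp [this]
    rw [add_mulVec, Pi.add_apply, mulVec_diagonal, hs]
    have := i.2
    simp only [d, e, Function.comp_apply, Pi.zero_apply]
    field_simp
    ring

/-- For a `P`-matrix `M` and `z ≠ 0`, there is a direction `u`, weakly of the signs of `z`, along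
which `M` moves every coordinate in the support of `z` strictly in the direction of the sign of `z`.
Otherwise a functional separating the image under `M` of the admissible `u` from the open cone
of admissible `M *ᵥ u` would be a vector whose sign is reversed by the `P`-matrix `Mᵀ`. -/
theorem IsPMatrix.exists_direction [Fintype ι] [DecidableEq ι] (hM : M.IsPMatrix) (z : ι → ℝ) :
    ∃ u : ι → ℝ, (∀ i, 0 ≤ z i * u i) ∧ (∀ i, z i = 0 → u i = 0) ∧
      ∀ i, z i ≠ 0 → 0 < z i * (M *ᵥ u) i := by
  let O : Set (ι → ℝ) := {v | ∀ i, z i ≠ 0 → 0 < z i * v i}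
  let U : Set (ι → ℝ) := {u | ∀ i, 0 ≤ z i * u i ∧ (z i = 0 → u i = 0)}
  by_contra! hno
  have hdisj : Disjoint O ((M *ᵥ ·) '' U) := by
    rw [Set.disjoint_left]
    rintro _ hv ⟨u, hu, rfl⟩
    obtain ⟨i, hi, hi'⟩ := hno u (fun i => (hu i).1) (fun i => (hu i).2)
    exact absurd (hv i hi) hi'.not_gt
  have hOopen : IsOpen O := by
    have : O = ⋂ i, {v : ι → ℝ | z i ≠ 0 → 0 < z i * v i} := by ext; simp [O]
    rw [this]
    refine isOpen_iInter_of_finite fun i => ?_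
    by_cases hi : z i = 0
    · simp [hi]
    · simp only [ne_eq, hi, not_false_eq_true, forall_const]
      exact isOpen_lt (by fun_prop) (by fun_prop)
  have hOconv : Convex ℝ O := by
    intro v hv w hw s t hs ht hst i hi
    have h1 := hv i hi
    have h2 := hw i hi
    simp only [Pi.add_apply, Pi.smul_apply, smul_eq_mul]
    have : z i * (s * v i + t * w i) = s * (z i * v i) + t * (z i * w i) := by ring
    rw [this]
    rcases hs.eq_or_lt with rfl | hs
    · have : t = 1 := by linarith
      subst this; linarith
    · positivity
  have hUconv : Convex ℝ ((M *ᵥ ·) '' U) := by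
    refine Convex.is_linear_image ?_ M.mulVecLin.isLinear
    intro v hv w hw s t hs ht _ i
    obtain ⟨h1, h1'⟩ := hv i
    obtain ⟨h2, h2'⟩ := hw i
    simp only [Pi.add_apply, Pi.smul_apply, smul_eq_mul]
    refine ⟨?_, fun h => by simp [h1' h, h2' h]⟩
    have : z i * (s * v i + t * w i) = s * (z i * v i) + t * (z i * w i) := by ring
    rw [this]
    positivity
  obtain ⟨f, c, hfO, hfU⟩ := geometric_hahn_banach_open hOconv hOopen hUconv hdisj
  let y : ι → ℝ := fun i => f (Pi.single i 1)
  have hf : ∀ v, f v = ∑ i, y i * v i := fun v => by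
    conv_lhs => rw [pi_eq_sum_univ' v]
    simp [y, mul_comm]
  have hfs : ∀ i t, f (Pi.single i t) = t * y i := fun i t => by
    rw [hf, Finset.sum_eq_single i] <;> simp +contextual [mul_comm]
  have hfM : ∀ i t, f (M *ᵥ Pi.single i t) = t * (Mᵀ *ᵥ y) i := fun i t => by
    rw [hf, mulVec_single]
    simp only [mulVec, dotProduct, Finset.mul_sum, transpose_apply]
    exact Finset.sum_congr rfl fun j _ => by simp; ring
  have hc : c ≤ 0 := by
    simpa using hfU _ ⟨0, fun i => by simp, rfl⟩
  have hz : f z < 0 := (hfO z fun i hi => mul_self_pos.2 hi).trans_le hc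
  have hy0 : y ≠ 0 := fun h => by
    rw [hf] at hz
    simp [h] at hz
  have hO : ∀ i t, 0 ≤ z i * t → f z + t * y i < 0 := fun i t ht => by
    rw [← hfs, ← map_add]
    refine (hfO _ fun j hj => ?_).trans_le hc
    have hzj : 0 < z j * z j := mul_self_pos.2 hj
    by_cases hij : j = i
    · subst hij; simp [mul_add]; linarith
    · simpa [hij] using hj
  have hU : ∀ i t, 0 ≤ z i * t → (z i = 0 → t = 0) → c ≤ t * (Mᵀ *ᵥ y) i := fun i t ht ht' => by
    rw [← hfM]
    refine hfU _ ⟨_, fun j => ?_, rfl⟩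
    by_cases hij : j = i
    · subst hij; simpa using ⟨ht, ht'⟩
    · simp [hij]
  -- An affine function bounded above on `[0, ∞)` has nonpositive slope.
  have ray : ∀ p s b : ℝ, (∀ T, 0 ≤ T → p + T * s < b) → s ≤ 0 := fun p s b h => by
    by_contra! hs
    have := h ((|b - p|) / s) (by positivity)
    rw [div_mul_cancel₀ _ hs.ne'] at this
    linarith [le_abs_self (b - p)]
  obtain ⟨i, hi⟩ := hM.transpose.exists_mul_mulVec_pos hy0
  by_cases hzi : z i = 0
  · have h1 : y i ≤ 0 := ray (f z) _ 0 fun T _ => hO i T (by simp [hzi])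
    have h2 : -y i ≤ 0 := ray (f z) _ 0 fun T _ => by
      have := hO i (-T) (by simp [hzi]); linarith
    have : y i = 0 := by linarith
    simp [this] at hi
  · have hsq : 0 < z i * z i := mul_self_pos.2 hzi
    have h1 : z i * y i ≤ 0 := ray (f z) _ 0 fun T hT => by
      have := hO i (T * z i) (by nlinarith); linarith
    have h2 : -(z i * (Mᵀ *ᵥ y) i) ≤ 0 := ray 0 _ (-c + 1) fun T hT => by
      have := hU i (T * z i) (by nlinarith) (fun h => absurd h hzi); linarith
    have h3 := mul_pos hsq hi
    have : z i * z i * (y i * (Mᵀ *ᵥ y) i) = (z i * y i) * (z i * (Mᵀ *ᵥ y) i) := by ring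
    nlinarith

end Matrix

/-! ### Determinants of products and signs of permutations -/

/-- The Cauchy–Binet expansion before terms with the same column set are collected: `p` ranges over
the injective choices of inner indices. -/
theorem Matrix.det_mul_eq_sum_injective {κ μ : Type*} [Fintype κ] [DecidableEq κ] [Fintype μ]
    [DecidableEq μ] (A : Matrix κ μ ℝ) (B : Matrix μ κ ℝ) :
    (A * B).det = ∑ p : κ → μ with Function.Injective p, ∑ σ : Equiv.Perm κ,
      ((Equiv.Perm.sign σ : ℤ) : ℝ) * ∏ i, A (σ i) (p i) * B (p i) i := by
  simp only [Matrix.det_apply', Matrix.mul_apply, Finset.prod_univ_sum, Finset.mul_sum,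
    Fintype.piFinset_univ]
  rw [Finset.sum_comm]
  refine (Finset.sum_filter_of_ne fun p _ hp => ?_).symm
  by_contra hinj
  obtain ⟨i, j, hij, hne⟩ : ∃ i j, p i = p j ∧ i ≠ j := by
    simpa [Function.Injective] using hinj
  refine hp ?_
  have h0 : (A.submatrix id p).det = 0 :=
    Matrix.det_zero_of_column_eq hne fun k => by simp [hij]
  rw [Matrix.det_apply'] at h0
  simp only [Matrix.submatrix_apply, id] at h0
  simp only [Finset.prod_mul_distrib, ← mul_assoc]
  rw [← Finset.sum_mul, h0, zero_mul]

/-- A signed product over a permutation is nonnegative when its restriction to each cycle is. -/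
theorem Equiv.Perm.sign_mul_prod_nonneg {κ : Type*} [Fintype κ] [DecidableEq κ]
    (σ : Equiv.Perm κ) (w : κ → ℝ) (hfix : ∀ i, σ i = i → 0 ≤ w i)
    (hcyc : ∀ c ∈ σ.cycleFactorsFinset,
      0 ≤ ((Equiv.Perm.sign c : ℤ) : ℝ) * ∏ i ∈ c.support, w i) :
    0 ≤ ((Equiv.Perm.sign σ : ℤ) : ℝ) * ∏ i, w i := by
  have key : 0 ≤ ((Equiv.Perm.sign σ : ℤ) : ℝ) * ∏ i ∈ σ.support, w i := by
    clear hfix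
    induction σ using Equiv.Perm.cycle_induction_on with
    | base_one => simp
    | base_cycles σ hσ =>
      exact hcyc σ (by rw [Equiv.Perm.cycleFactorsFinset_eq_singleton_self_iff.2 hσ]; simp)
    | induction_disjoint σ τ hd _ ihσ ihτ =>
      rw [hd.cycleFactorsFinset_mul_eq_union] at hcyc
      have h₁ := ihσ fun c hc => hcyc c (Finset.mem_union_left _ hc)
      have h₂ := ihτ fun c hc => hcyc c (Finset.mem_union_right _ hc)
      rw [hd.support_mul, Finset.prod_union hd.disjoint_support, Equiv.Perm.sign_mul]
      push_cast
      calc (0 : ℝ) ≤ _ := mul_nonneg h₁ h₂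
        _ = _ := by ring
  rw [← Finset.prod_mul_prod_compl σ.support, ← mul_assoc]
  exact mul_nonneg key (Finset.prod_nonneg fun i hi => hfix i (by simpa using hi))

/-! ### Terms of the determinant and cycles of the DSR graph -/

/-- The sign of a nonzero real number, as a unit of `ℤ`; the value at `0` is irrelevant. -/
noncomputable def unitSign (x : ℝ) : ℤˣ := if 0 < x then 1 else -1

theorem unitSign_mul_self_pos {x : ℝ} (hx : x ≠ 0) : 0 < ((unitSign x : ℤ) : ℝ) * x := by
  unfold unitSign
  split_ifs with h
  · simpa using h
  · simpa using lt_of_le_of_ne (not_lt.1 h) hx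

namespace DSRGraph

variable {n m : ℕ} {A : Matrix (Fin n) (Fin m) ℝ} {B : Matrix (Fin m) (Fin n) ℝ}

theorem dsrGraph_StoR_unitSign {i : Fin n} {j : Fin m} (h : B j i ≠ 0) :
    (dsrGraph A B.transpose).StoR ⟨i, j, unitSign (B j i)⟩ :=
  unitSign_mul_self_pos h

theorem dsrGraph_RtoS_unitSign {i : Fin n} {j : Fin m} (h : A i j ≠ 0) :
    (dsrGraph A B.transpose).RtoS ⟨i, j, unitSign (A i j)⟩ :=
  unitSign_mul_self_pos h

theorem ne_zero_of_dsrGraph_StoR {e : DSREdge n m} (h : (dsrGraph A B.transpose).StoR e) :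
    B e.r e.s ≠ 0 := fun h0 => by
  have h' : 0 < ((e.sign : ℤ) : ℝ) * B e.r e.s := h
  simp [h0] at h'

theorem ne_zero_of_dsrGraph_RtoS {e : DSREdge n m} (h : (dsrGraph A B.transpose).RtoS e) :
    A e.s e.r ≠ 0 := fun h0 => by
  have h' : 0 < ((e.sign : ℤ) : ℝ) * A e.s e.r := h
  simp [h0] at h'

/-- Two edges of opposite signs between the same vertices would form an e-cycle of length two. -/
theorem NoECycles.mul_nonneg (hG : (dsrGraph A B.transpose).NoECycles) (i : Fin n) (j : Fin m) :
    0 ≤ A i j * B j i := by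
  by_contra! h
  have hA : A i j ≠ 0 := fun h0 => by simp [h0] at h
  have hB : B j i ≠ 0 := fun h0 => by simp [h0] at h
  have hs : unitSign (B j i) * unitSign (A i j) = -1 := by
    unfold unitSign
    rcases mul_neg_iff.1 h with h | h
    · simp [h.1, h.2.not_gt]
    · simp [h.1.not_gt, h.2]
  let C : (dsrGraph A B.transpose).Cycle :=
    { h := 0
      out := fun _ => ⟨i, j, unitSign (B j i)⟩
      back := fun _ => ⟨i, j, unitSign (A i j)⟩
      out_dir := fun _ => dsrGraph_StoR_unitSign hB
      back_dir := fun _ => dsrGraph_RtoS_unitSign hA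
      adj_r := fun _ => rfl
      adj_s := fun _ => rfl
      s_injective := fun k l _ => Subsingleton.elim (α := Fin 1) k l
      r_injective := fun k l _ => Subsingleton.elim (α := Fin 1) k l
      edge_ne := fun _ _ h => by
        have h' : unitSign (B j i) = unitSign (A i j) := (DSREdge.ext_iff.1 h).2.2
        rw [h'] at hs
        rcases Int.units_eq_one_or (unitSign (A i j)) with h | h <;> simp [h] at hs }
  refine hG C ?_
  change (-1 : ℤˣ) ^ (2 * (0 + 1) / 2) *
    ((∏ _k : Fin (0 + 1), unitSign (B j i)) * ∏ _k : Fin (0 + 1), unitSign (A i j)) = 1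
  simp [hs]

/-- The factor of a term of the determinant belonging to a cycle `c` of the permutation: when it is
nonzero, following edges `i → p i → c i` gives a cycle of the graph, and `sign c` is the sign
this cycle must have in order not to be an e-cycle. -/
theorem NoECycles.sign_mul_prod_nonneg_of_isCycle (hG : (dsrGraph A B.transpose).NoECycles)
    {κ : Type*} [Fintype κ] [DecidableEq κ] {c : Equiv.Perm κ} (hc : c.IsCycle)
    {e : κ → Fin n} (he : Function.Injective e) {p : κ → Fin m} (hp : Function.Injective p) :
    0 ≤ ((Equiv.Perm.sign c : ℤ) : ℝ) *
      ∏ i ∈ c.support, A (e (c i)) (p i) * B (p i) (e i) := by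
  by_cases hzero : ∃ i ∈ c.support, A (e (c i)) (p i) * B (p i) (e i) = 0
  · obtain ⟨i, hi, h0⟩ := hzero
    rw [Finset.prod_eq_zero hi h0, mul_zero]
  push Not at hzero
  obtain ⟨x, hx, -⟩ := id hc
  obtain ⟨h, hcard⟩ : ∃ h, c.support.card = h + 1 :=
    Nat.exists_eq_succ_of_ne_zero (Finset.card_pos.2 ⟨x, Equiv.Perm.mem_support.2 hx⟩).ne'
  have hord : orderOf c = h + 1 := hc.orderOf.trans hcard
  have hmod : ∀ j : ℕ, c ^ (j % (h + 1)) = c ^ j := fun j => by rw [← hord, pow_mod_orderOf]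
  let s : Fin (h + 1) → κ := fun k => (c ^ (k : ℕ)) x
  have hs_mem : ∀ k, s k ∈ c.support := fun k =>
    Equiv.Perm.pow_apply_mem_support.2 (Equiv.Perm.mem_support.2 hx)
  have hs_succ : ∀ k, s (k + 1) = c (s k) := fun k => by
    simp only [s]
    rw [Fin.val_add, hmod, pow_add, Fin.val_one', hmod, pow_one, ← pow_succ, pow_succ',
      Equiv.Perm.mul_apply]
  have hs_surj : ∀ y ∈ c.support, ∃ k, s k = y := fun y hy => by
    obtain ⟨i, hi⟩ := hc.exists_pow_eq hx (Equiv.Perm.mem_support.1 hy)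
    refine ⟨⟨i % (h + 1), Nat.mod_lt _ h.succ_pos⟩, ?_⟩
    simp only [s]
    rw [hmod, hi]
  have himage : Finset.univ.image s = c.support := by
    ext y
    simp only [Finset.mem_image, Finset.mem_univ, true_and]
    exact ⟨fun ⟨k, hk⟩ => hk ▸ hs_mem k, hs_surj y⟩
  have hs_inj : Function.Injective s := by
    have := (Finset.card_image_iff (s := Finset.univ) (f := s)).1 (by rw [himage, hcard]; simp)
    rwa [Finset.coe_univ, Set.injOn_univ] at this
  have hA : ∀ k, A (e (c (s k))) (p (s k)) ≠ 0 := fun k => left_ne_zero_of_mul (hzero _ (hs_mem k))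
  have hB : ∀ k, B (p (s k)) (e (s k)) ≠ 0 := fun k => right_ne_zero_of_mul (hzero _ (hs_mem k))
  let C : (dsrGraph A B.transpose).Cycle :=
    { h := h
      out := fun k => ⟨e (s k), p (s k), unitSign (B (p (s k)) (e (s k)))⟩
      back := fun k => ⟨e (c (s k)), p (s k), unitSign (A (e (c (s k))) (p (s k)))⟩
      out_dir := fun k => dsrGraph_StoR_unitSign (hB k)
      back_dir := fun k => dsrGraph_RtoS_unitSign (hA k)
      adj_r := fun _ => rfl
      adj_s := fun k => by simp only [hs_succ]
      s_injective := he.comp hs_inj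
      r_injective := hp.comp hs_inj
      edge_ne := fun k l hkl => by
        obtain ⟨h₁, h₂, -⟩ := DSREdge.ext_iff.1 hkl
        have h₁ : s k = c (s l) := he h₁
        have h₂ : s k = s l := hp h₂
        exact Equiv.Perm.mem_support.1 (hs_mem l) (h₁.symm.trans h₂) }
  have hsign : Equiv.Perm.sign c = C.sign := by
    have hpar : C.parity = -1 := (Int.units_eq_one_or _).resolve_left (hG C)
    have hlen : C.length / 2 = h + 1 := by simp [Cycle.length, C]
    rw [Cycle.parity, hlen] at hpar
    calc Equiv.Perm.sign c = (-1) ^ (h + 1) * -1 := by rw [hc.sign, hcard]; simp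
      _ = (-1) ^ (h + 1) * ((-1) ^ (h + 1) * C.sign) := by rw [hpar]
      _ = C.sign := by rw [← mul_assoc, ← mul_pow]; simp
  rw [hsign, ← himage, Finset.prod_image fun _ _ _ _ h => hs_inj h]
  change 0 ≤ ((((∏ k, unitSign (B (p (s k)) (e (s k)))) *
    ∏ k, unitSign (A (e (c (s k))) (p (s k))) : ℤˣ) : ℤ) : ℝ) * _
  push_cast
  rw [← Finset.prod_mul_distrib, ← Finset.prod_mul_distrib]
  refine Finset.prod_nonneg fun k _ => ?_
  have := mul_pos (unitSign_mul_self_pos (hA k)) (unitSign_mul_self_pos (hB k))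
  linarith

/-- In the absence of e-cycles all terms of a principal minor of `A * B` are nonnegative. -/
theorem NoECycles.sign_mul_prod_nonneg (hG : (dsrGraph A B.transpose).NoECycles)
    {κ : Type*} [Fintype κ] [DecidableEq κ] (σ : Equiv.Perm κ)
    {e : κ → Fin n} (he : Function.Injective e) {p : κ → Fin m} (hp : Function.Injective p) :
    0 ≤ ((Equiv.Perm.sign σ : ℤ) : ℝ) * ∏ i, A (e (σ i)) (p i) * B (p i) (e i) := by
  refine σ.sign_mul_prod_nonneg _ (fun i hi => ?_) fun c hc => ?_
  · rw [hi]
    exact hG.mul_nonneg _ _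
  · obtain ⟨hcyc, hcσ⟩ := Equiv.Perm.mem_cycleFactorsFinset_iff.1 hc
    rw [Finset.prod_congr rfl fun i hi => by rw [← hcσ i hi]]
    exact hG.sign_mul_prod_nonneg_of_isCycle hcyc he hp

theorem det_submatrix_mul {κ : Type*} [Fintype κ] [DecidableEq κ] (e : κ → Fin n) :
    ((A * B).submatrix e e).det = ∑ p : κ → Fin m with Function.Injective p,
      ∑ σ : Equiv.Perm κ,
        ((Equiv.Perm.sign σ : ℤ) : ℝ) * ∏ i, A (e (σ i)) (p i) * B (p i) (e i) := by
  rw [← Matrix.submatrix_mul_equiv (e₂ := Equiv.refl _), Matrix.det_mul_eq_sum_injective]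
  rfl

theorem NoECycles.isP0Matrix (hG : (dsrGraph A B.transpose).NoECycles) :
    (A * B).IsP0Matrix := fun κ _ _ e he => by
  rw [det_submatrix_mul]
  exact Finset.sum_nonneg fun p hp => Finset.sum_nonneg fun σ _ =>
    hG.sign_mul_prod_nonneg σ he (Finset.mem_filter.1 hp).2

/-- A term subgraph is the graph of a bijection between its vertex sets. -/
theorem IsTermSubgraph.exists_equiv {G : DSRGraph n m} {γ : Finset (Fin n)} {δ : Finset (Fin m)}
    {T : Set (DSREdge n m)} (hT : G.IsTermSubgraph γ δ T) :
    ∃ b : γ ≃ δ, ∀ i : γ, ∃ e ∈ T, e.s = i ∧ e.r = b i := by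
  obtain ⟨hcard, hmem, hγ, hδ⟩ := hT
  choose E hE hEu using fun i : γ => hγ i i.2
  let b : γ → δ := fun i => ⟨(E i).r, (hmem _ (hE i).1).2.2⟩
  have hb : Function.Injective b := fun i j hij => by
    have hr : (E i).r = (E j).r := Subtype.ext_iff.1 hij
    have := (hδ _ (b j).2).unique ⟨(hE i).1, hr⟩ ⟨(hE j).1, rfl⟩
    exact Subtype.ext ((hE i).2.symm.trans ((congrArg DSREdge.s this).trans (hE j).2))
  refine ⟨Equiv.ofBijective b ((Fintype.bijective_iff_injective_and_card b).2 ⟨hb, by simpa⟩),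
    fun i => ⟨E i, (hE i).1, (hE i).2, rfl⟩⟩

/-- Term subgraphs with the two directions on the same vertex sets provide a nonzero term of the
principal minor. -/
theorem NoECycles.det_submatrix_pos (hG : (dsrGraph A B.transpose).NoECycles)
    {γ : Finset (Fin n)} {δ : Finset (Fin m)} (h : (dsrGraph A B.transpose).HasBothTerms γ δ) :
    0 < ((A * B).submatrix (Subtype.val : γ → Fin n) Subtype.val).det := by
  obtain ⟨⟨T, hT, hTdir⟩, ⟨T', hT', hTdir'⟩⟩ := h
  obtain ⟨b, hb⟩ := hT.exists_equiv
  obtain ⟨a, ha⟩ := hT'.exists_equiv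
  rw [det_submatrix_mul]
  have he : Function.Injective (Subtype.val : γ → Fin n) := Subtype.val_injective
  let p : γ → Fin m := fun i => b i
  let σ : Equiv.Perm γ := b.trans a.symm
  have hp : Function.Injective p := Subtype.val_injective.comp b.injective
  refine Finset.sum_pos' (fun p hp => Finset.sum_nonneg fun σ _ =>
    hG.sign_mul_prod_nonneg σ he (Finset.mem_filter.1 hp).2) ⟨p, by simp [hp], ?_⟩
  refine Finset.sum_pos' (fun σ _ => hG.sign_mul_prod_nonneg σ he hp) ⟨σ, Finset.mem_univ _, ?_⟩
  refine lt_of_le_of_ne (hG.sign_mul_prod_nonneg σ he hp) (Ne.symm (mul_ne_zero (by simp) ?_))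
  refine Finset.prod_ne_zero_iff.2 fun i _ => mul_ne_zero ?_ ?_
  · obtain ⟨E, hE, hs, hr⟩ := ha (σ i)
    have : (a (σ i) : Fin m) = p i := by simp [σ, p]
    rw [← hs, ← this, ← hr]
    exact ne_zero_of_dsrGraph_RtoS (hTdir' E hE)
  · obtain ⟨E, hE, hs, hr⟩ := hb i
    change B (b i) i ≠ 0
    rw [← hs, ← hr]
    exact ne_zero_of_dsrGraph_StoR (hTdir E hE)

theorem NoECycles.isPMatrix (hG : (dsrGraph A B.transpose).NoECycles)
    (hnd : (dsrGraph A B.transpose).Nondegenerate) : (A * B).IsPMatrix := fun κ _ _ e he => by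
  cases isEmpty_or_nonempty κ
  · simp
  obtain ⟨δ, -, hδ⟩ := hnd (Finset.univ.image e) (Finset.univ_nonempty.image e)
  let E : κ ≃ Finset.univ.image e :=
    Equiv.ofBijective (fun i => ⟨e i, Finset.mem_image_of_mem e (Finset.mem_univ i)⟩)
      ⟨fun i j h => he (Subtype.ext_iff.1 h), fun ⟨j, hj⟩ => by
        obtain ⟨i, -, rfl⟩ := Finset.mem_image.1 hj
        exact ⟨i, rfl⟩⟩
  have h := hG.det_submatrix_pos hδ
  rwa [← Matrix.det_submatrix_equiv_self E] at h

theorem NoECycles.det_pos (hG : (dsrGraph A B.transpose).NoECycles)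
    (hnd : (dsrGraph A B.transpose).WeaklyNondegenerate) : 0 < (A * B).det := by
  obtain ⟨δ, -, hδ⟩ := hnd
  have h := hG.det_submatrix_pos hδ
  rwa [← Matrix.det_submatrix_equiv_self (Equiv.subtypeUnivEquiv (by simp)).symm] at h

end DSRGraph

/-! ### Jacobians relative to a set -/

section Jacobian

variable {n : ℕ} {X : Set (Fin n → ℝ)} {f g : (Fin n → ℝ) → (Fin n → ℝ)}
  {Df Dg : (Fin n → ℝ) → Matrix (Fin n) (Fin n) ℝ}

theorem HasJacobianOn.neg (hf : HasJacobianOn f Df X) :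
    HasJacobianOn (-f) (fun x => -Df x) X := fun x hx => by
  simpa only [map_neg] using (hf x hx).neg

theorem HasJacobianOn.add (hf : HasJacobianOn f Df X) (hg : HasJacobianOn g Dg X) :
    HasJacobianOn (f + g) (fun x => Df x + Dg x) X := fun x hx => by
  simpa only [map_add] using (hf x hx).add (hg x hx)

theorem exists_hasJacobianOn_of_mem_posDiagonal {q : (Fin n → ℝ) → (Fin n → ℝ)}
    (hq : q ∈ posDiagonal X) : ∃ d : (Fin n → ℝ) → Fin n → ℝ,
      (∀ x ∈ X, ∀ i, 0 < d x i) ∧ HasJacobianOn q (fun x => Matrix.diagonal (d x)) X := by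
  obtain ⟨φ, hqφ, hφ⟩ := hq
  choose! d hdpos hd using hφ
  refine ⟨fun x i => d i (x i), fun x hx i => hdpos i _ ⟨x, hx, rfl⟩, fun x hx => ?_⟩
  rw [hasFDerivWithinAt_pi']
  intro i
  have hproj : HasFDerivWithinAt (fun y : Fin n → ℝ => y i)
      (ContinuousLinearMap.proj (R := ℝ) (φ := fun _ : Fin n => ℝ) i) X x :=
    (ContinuousLinearMap.proj (R := ℝ) (φ := fun _ : Fin n => ℝ) i).hasFDerivWithinAt
  have h := (hd i (x i) ⟨x, hx, rfl⟩).comp_hasFDerivWithinAt x hproj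
    fun y hy => Set.mem_image_of_mem _ hy
  refine (h.congr (fun y hy => hqφ y hy i) (hqφ x hx i)).congr_fderiv ?_
  ext v
  simp [Matrix.mulVec_diagonal]

theorem smul_id_mem_posDiagonal (X : Set (Fin n → ℝ)) {ε : ℝ} (hε : 0 < ε) :
    (fun x => ε • x) ∈ posDiagonal X :=
  ⟨fun _ t => ε * t, fun _ _ _ => rfl, fun _ t _ =>
    ⟨ε, hε, by simpa using ((hasDerivAt_id t).const_mul ε).hasDerivWithinAt⟩⟩

/-! ### Injectivity of maps with P-matrix Jacobians -/

/-- A lower bound for the failure of sign reversal by a `P`-matrix, by compactness of the sphere. -/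
theorem Matrix.IsPMatrix.exists_le_sum_max {M : Matrix (Fin n) (Fin n) ℝ} (hM : M.IsPMatrix) :
    ∃ c : ℝ, 0 < c ∧ ∀ z, c * ‖z‖ ^ 2 ≤ ∑ i, max (z i * (M.mulVec z) i) 0 := by
  obtain ⟨c, hc, hle⟩ := (isCompact_sphere (0 : Fin n → ℝ) 1).exists_forall_le' (a := (0 : ℝ))
    (f := fun z => ∑ i, max (z i * (M.mulVec z) i) 0)
    (by
      refine Continuous.continuousOn (continuous_finsetSum _ fun i _ => ?_)
      have : Continuous fun z : Fin n → ℝ => M.mulVec z :=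
        continuous_const.matrix_mulVec continuous_id
      fun_prop)
    (fun z hz => by
      have hz0 : z ≠ 0 := fun h => by simp [h] at hz
      obtain ⟨i, hi⟩ := hM.exists_mul_mulVec_pos hz0
      exact Finset.sum_pos' (fun _ _ => le_max_right _ _)
        ⟨i, Finset.mem_univ _, lt_max_of_lt_left hi⟩)
  refine ⟨c, hc, fun z => ?_⟩
  rcases eq_or_ne z 0 with rfl | hz
  · simp
  have hz' : 0 < ‖z‖ := norm_pos_iff.2 hz
  have h := hle (‖z‖⁻¹ • z) (by simp [norm_smul, hz'.ne'])
  have hsum : ∑ i, max ((‖z‖⁻¹ • z) i * (M.mulVec (‖z‖⁻¹ • z)) i) 0 =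
      (‖z‖ ^ 2)⁻¹ * ∑ i, max (z i * (M.mulVec z) i) 0 := by
    rw [Finset.mul_sum]
    refine Finset.sum_congr rfl fun i _ => ?_
    rw [mul_max_of_nonneg _ _ (by positivity), mul_zero, Matrix.mulVec_smul]
    simp only [Pi.smul_apply, smul_eq_mul]
    congr 1
    rw [← inv_pow]
    ring
  rw [hsum, inv_mul_eq_div, le_div_iff₀ (by positivity)] at h
  exact h

/-- Near a point with `P`-matrix Jacobian, no increment of the argument has its sign reversed. -/
theorem HasFDerivWithinAt.eventually_exists_mul_sub_pos {M : Matrix (Fin n) (Fin n) ℝ}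
    {a : Fin n → ℝ} (hM : M.IsPMatrix)
    (hf : HasFDerivWithinAt f (LinearMap.toContinuousLinearMap (Matrix.toLin' M)) X a) :
    ∀ᶠ x in nhdsWithin a X, x ≠ a → ∃ i, 0 < (x i - a i) * (f x i - f a i) := by
  obtain ⟨c, hc, hle⟩ := hM.exists_le_sum_max
  have hη : 0 < c / (n + 1) := by positivity
  filter_upwards [(hasFDerivWithinAt_iff_isLittleO.1 hf).def hη] with x hx hxa
  by_contra! hno
  set z := x - a with hz
  have hz0 : 0 < ‖z‖ := norm_pos_iff.2 (sub_ne_zero.2 hxa)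
  have hterm : ∀ i, max (z i * (M.mulVec z) i) 0 ≤ c / (n + 1) * ‖z‖ ^ 2 := fun i => by
    refine max_le ?_ (by positivity)
    have h₁ : |f x i - f a i - M.mulVec z i| ≤ c / (n + 1) * ‖z‖ :=
      (norm_le_pi_norm (f x - f a - M.mulVec z) i).trans hx
    have h₂ : |z i| ≤ ‖z‖ := norm_le_pi_norm z i
    have h₃ : |z i * (f x i - f a i - M.mulVec z i)| ≤ ‖z‖ * (c / (n + 1) * ‖z‖) := by
      rw [abs_mul]
      exact mul_le_mul h₂ h₁ (abs_nonneg _) hz0.le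
    have h₄ := hno i
    have h₅ := neg_abs_le (z i * (f x i - f a i - M.mulVec z i))
    have h₆ : z i = x i - a i := rfl
    rw [← h₆] at h₄
    nlinarith
  have hsum := (hle z).trans (Finset.sum_le_sum fun i _ => hterm i)
  simp only [Finset.sum_const, Finset.card_univ, Fintype.card_fin, nsmul_eq_mul] at hsum
  have h₇ : (n : ℝ) * (c / (n + 1) * ‖z‖ ^ 2) = c * ‖z‖ ^ 2 - c / (n + 1) * ‖z‖ ^ 2 := by
    field_simp
    ring
  have h₈ : 0 < c / (n + 1) * ‖z‖ ^ 2 := by positivity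
  linarith

/-- Moving a little from `x` against a direction `u` along which the `i`-th component of `f` moves
with the sign of `z i` makes a weakly reversed sign of `f x i - y i` strictly reversed. -/
theorem HasFDerivWithinAt.eventually_mul_sub_neg {M : Matrix (Fin n) (Fin n) ℝ}
    {x u y z : Fin n → ℝ}
    (hf : HasFDerivWithinAt f (LinearMap.toContinuousLinearMap (Matrix.toLin' M)) X x)
    (hX : ∀ᶠ t in nhdsWithin (0 : ℝ) (Set.Ioi 0), x - t • u ∈ X) {i : Fin n}
    (hz : z i * (f x i - y i) ≤ 0) (hu : 0 < z i * (M.mulVec u) i) :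
    ∀ᶠ t in nhdsWithin (0 : ℝ) (Set.Ioi 0), z i * (f (x - t • u) i - y i) < 0 := by
  have hη : 0 < z i * (M.mulVec u) i / (|z i| * ‖u‖ + 1) := by positivity
  have hlim : Filter.Tendsto (fun t : ℝ => x - t • u) (nhdsWithin 0 (Set.Ioi 0))
      (nhdsWithin x X) := by
    refine tendsto_nhdsWithin_iff.2 ⟨?_, hX⟩
    have : Continuous fun t : ℝ => x - t • u := by fun_prop
    simpa using (this.tendsto 0).mono_left nhdsWithin_le_nhds
  filter_upwards [hlim.eventually ((hasFDerivWithinAt_iff_isLittleO.1 hf).def hη),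
    self_mem_nhdsWithin] with t ht ht0
  have ht0 : 0 < t := ht0
  set η := z i * (M.mulVec u) i / (|z i| * ‖u‖ + 1) with hηdef
  have hηeq : η * (|z i| * ‖u‖ + 1) = z i * (M.mulVec u) i := div_mul_cancel₀ _ (by positivity)
  have h₁ : |f (x - t • u) i - f x i + t * M.mulVec u i| ≤ η * (t * ‖u‖) := by
    have h := (norm_le_pi_norm _ i).trans ht
    have e₁ : x - t • u - x = -(t • u) := by abel
    rw [e₁, norm_neg, norm_smul, Real.norm_of_nonneg ht0.le] at h
    simpa [Matrix.mulVec_neg, Matrix.mulVec_smul] using h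
  have h₂ : z i * (f (x - t • u) i - f x i + t * M.mulVec u i) ≤ |z i| * (η * (t * ‖u‖)) := by
    refine (le_abs_self _).trans ?_
    rw [abs_mul]
    exact mul_le_mul_of_nonneg_left h₁ (abs_nonneg _)
  have h₃ : 0 < η * t := mul_pos hη ht0
  nlinarith

/-- A map with `P`-matrix Jacobian on a rectangular region is a `P`-function. If the signs of
`b - a` are reversed, consider among the points of the box spanned by `a` and `b`
with reversed signs, other than the isolated one `a`, one nearest to `a`: it can be moved closer
to `a`. -/
theorem HasJacobianOn.exists_mul_sub_pos (hX : IsRectangular X) (hf : HasJacobianOn f Df X)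
    (hP : ∀ x ∈ X, (Df x).IsPMatrix) {a b : Fin n → ℝ} (ha : a ∈ X) (hb : b ∈ X) (hab : b ≠ a) :
    ∃ i, 0 < (b i - a i) * (f b i - f a i) := by
  by_contra! hno
  let box : Set (Fin n → ℝ) := Set.univ.pi fun i => Set.uIcc (a i) (b i)
  have hboxX : box ⊆ X := by
    obtain ⟨I, hI, rfl⟩ := hX
    exact Set.pi_mono fun i _ => (hI i).uIcc_subset (ha i trivial) (hb i trivial)
  have hbox : IsCompact box := isCompact_univ_pi fun i => isCompact_uIcc
  let K : Set (Fin n → ℝ) := box ∩ (fun x i => (x i - a i) * (f x i - f a i)) ⁻¹' Set.Iic 0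
  have hfcont : ContinuousOn f box := fun x hx =>
    (hf x (hboxX hx)).continuousWithinAt.mono hboxX
  have hK : IsClosed K := by
    refine ContinuousOn.preimage_isClosed_of_isClosed ?_ hbox.isClosed isClosed_Iic
    refine continuousOn_pi.2 fun i => ?_
    have := continuousOn_pi.1 hfcont i
    fun_prop
  obtain ⟨r, hr, hball⟩ := Metric.mem_nhdsWithin_iff.1
    ((hf a ha).eventually_exists_mul_sub_pos (hP a ha))
  have hiso : ∀ x ∈ K, x ≠ a → x ∉ Metric.ball a r := fun x hx hxa hxr => by
    obtain ⟨i, hi⟩ := hball ⟨hxr, hboxX hx.1⟩ hxa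
    exact (hx.2 i).not_gt hi
  have hbK : b ∈ K := ⟨fun i _ => Set.right_mem_uIcc, hno⟩
  have hK' : IsCompact (K \ Metric.ball a r) :=
    hbox.of_isClosed_subset (hK.sdiff Metric.isOpen_ball) fun x hx => hx.1.1
  obtain ⟨x, ⟨hxK, hxr⟩, hmin⟩ := hK'.exists_isMinOn (f := fun x => ∑ i, |x i - a i|)
    ⟨b, hbK, hiso b hbK hab⟩ (by fun_prop)
  have hxX : x ∈ X := hboxX hxK.1
  have hxa : x ≠ a := fun h => hxr (h ▸ Metric.mem_ball_self hr)
  let z : Fin n → ℝ := x - a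
  have hzdef : ∀ i, z i = x i - a i := fun i => rfl
  obtain ⟨j, hj⟩ : ∃ j, z j ≠ 0 := Function.ne_iff.1 (sub_ne_zero.2 hxa)
  obtain ⟨u, hu₁, hu₂, hu₃⟩ := (hP x hxX).exists_direction z
  have hu0 : u ≠ 0 := fun h => by simpa [h] using hu₃ j hj
  obtain ⟨k, hk⟩ : ∃ k, u k ≠ 0 := Function.ne_iff.1 hu0
  have hsmall : ∀ᶠ t in nhdsWithin (0 : ℝ) (Set.Ioi 0), ∀ i, z i ≠ 0 → t * |u i| < |z i| := by
    refine Filter.eventually_all.2 fun i => ?_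
    by_cases hi : z i = 0
    · simp [hi]
    have hcont : Continuous fun t : ℝ => t * |u i| := by fun_prop
    have : ∀ᶠ t in nhds (0 : ℝ), t * |u i| < |z i| :=
      hcont.continuousAt.eventually_lt continuousAt_const (by simpa using hi)
    exact (this.filter_mono nhdsWithin_le_nhds).mono fun t ht _ => ht
  -- Each coordinate moves towards that of `a` without passing it.
  have hcoord : ∀ t, 0 < t → (∀ i, z i ≠ 0 → t * |u i| < |z i|) → ∀ i,
      |z i - t * u i| = |z i| - t * |u i| ∧ 0 ≤ z i * (z i - t * u i) ∧
        x i - t * u i ∈ Set.uIcc (a i) (x i) := by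
    intro t ht h i
    by_cases hi : z i = 0
    · have : a i = x i := by linarith [hzdef i]
      simp [hi, hu₂ i hi, this]
    have h₁ := h i hi
    have h₂ := hu₁ i
    rcases lt_or_gt_of_ne hi with hi | hi
    · have hui : u i ≤ 0 := by nlinarith
      rw [abs_of_neg hi, abs_of_nonpos hui] at h₁ ⊢
      have h₃ : z i - t * u i < 0 := by linarith
      rw [abs_of_neg h₃]
      refine ⟨by ring, by nlinarith, ?_⟩
      rw [Set.mem_uIcc]
      have := hzdef i
      right
      constructor <;> nlinarith
    · have hui : 0 ≤ u i := by nlinarith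
      rw [abs_of_pos hi, abs_of_nonneg hui] at h₁ ⊢
      have h₃ : 0 < z i - t * u i := by linarith
      rw [abs_of_pos h₃]
      refine ⟨by ring, by nlinarith, ?_⟩
      rw [Set.mem_uIcc]
      have := hzdef i
      left
      constructor <;> nlinarith
  have hinbox : ∀ᶠ t in nhdsWithin (0 : ℝ) (Set.Ioi 0), x - t • u ∈ box := by
    filter_upwards [hsmall, self_mem_nhdsWithin] with t ht ht0 i _
    exact Set.uIcc_subset_uIcc_left (hxK.1 i trivial) (hcoord t ht0 ht i).2.2
  have hneg : ∀ᶠ t in nhdsWithin (0 : ℝ) (Set.Ioi 0), ∀ i, z i ≠ 0 →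
      z i * (f (x - t • u) i - f a i) < 0 := by
    refine Filter.eventually_all.2 fun i => ?_
    by_cases hi : z i = 0
    · simp [hi]
    exact ((hf x hxX).eventually_mul_sub_neg (hinbox.mono fun t ht => hboxX ht) (hxK.2 i)
      (hu₃ i hi)).mono fun t ht _ => ht
  obtain ⟨t, ht₁, ht₂, ht₃, ht0⟩ :=
    (hsmall.and (hinbox.and (hneg.and self_mem_nhdsWithin))).exists
  have ht0 : 0 < t := ht0
  have hw : ∀ i, (x - t • u) i - a i = z i - t * u i := fun i => by
    simp only [Pi.sub_apply, Pi.smul_apply, smul_eq_mul, hzdef]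
    ring
  have hwK : x - t • u ∈ K := by
    refine ⟨ht₂, fun i => ?_⟩
    change ((x - t • u) i - a i) * (f (x - t • u) i - f a i) ≤ 0
    rw [hw]
    by_cases hi : z i = 0
    · simp [hi, hu₂ i hi]
    have h₁ := (hcoord t ht0 ht₁ i).2.1
    have h₂ := ht₃ i hi
    have h₃ : 0 < z i * z i := mul_self_pos.2 hi
    by_contra! h₄
    have h₅ := mul_pos h₃ h₄
    nlinarith [mul_nonneg h₁ (neg_nonneg.2 h₂.le)]
  have hwa : x - t • u ≠ a := fun h => by
    have h₁ := (hcoord t ht0 ht₁ j).1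
    rw [← hw, h, sub_self, abs_zero] at h₁
    linarith [ht₁ j hj]
  have hle : ∑ i, |x i - a i| ≤ ∑ i, |(x - t • u) i - a i| := hmin ⟨hwK, hiso _ hwK hwa⟩
  refine hle.not_gt (Finset.sum_lt_sum (fun i _ => ?_) ⟨k, Finset.mem_univ _, ?_⟩)
  · rw [hw, (hcoord t ht0 ht₁ i).1, ← hzdef]
    have : 0 ≤ t * |u i| := by positivity
    linarith
  · rw [hw, (hcoord t ht0 ht₁ k).1, ← hzdef]
    have : 0 < t * |u k| := by positivity
    linarith

/-- The Gale–Nikaido theorem for `P`-matrices. -/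
theorem HasJacobianOn.injOn_of_isPMatrix (hX : IsRectangular X) (hf : HasJacobianOn f Df X)
    (hP : ∀ x ∈ X, (Df x).IsPMatrix) : Set.InjOn f X := fun a ha b hb hab => by
  by_contra hne
  obtain ⟨i, hi⟩ := hf.exists_mul_sub_pos hX hP ha hb (Ne.symm hne)
  simp [hab] at hi

theorem HasJacobianOn.injOn_add_of_isP0Matrix (hX : IsRectangular X) (hf : HasJacobianOn f Df X)
    (hP : ∀ x ∈ X, (Df x).IsP0Matrix) {q : (Fin n → ℝ) → (Fin n → ℝ)} (hq : q ∈ posDiagonal X) :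
    Set.InjOn (f + q) X := by
  obtain ⟨d, hd, hqd⟩ := exists_hasJacobianOn_of_mem_posDiagonal hq
  exact (hf.add hqd).injOn_of_isPMatrix hX fun x hx => (hP x hx).add_diagonal (hd x hx)

/-! ### Injectivity of maps with nonsingular P₀-matrix Jacobians -/

/-- A differentiable map has a zero at every interior local minimum of its Euclidean length where
its Jacobian is nonsingular. -/
theorem HasFDerivAt.eq_zero_of_isLocalMin_sum_sq {M : Matrix (Fin n) (Fin n) ℝ}
    {y : Fin n → ℝ} (hf : HasFDerivAt f (LinearMap.toContinuousLinearMap (Matrix.toLin' M)) y)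
    (hM : M.det ≠ 0) (hmin : IsLocalMin (fun x => ∑ i, f x i ^ 2) y) : f y = 0 := by
  have hd := HasFDerivAt.fun_sum (u := Finset.univ) fun i _ => ((hasFDerivAt_pi'.1 hf) i).pow 2
  have h0 := hmin.hasFDerivAt_eq_zero hd
  by_contra hne
  refine hM (Matrix.exists_vecMul_eq_zero_iff.1 ⟨f y, hne, funext fun j => ?_⟩)
  have h1 := congrArg (fun L => L (Pi.single j 1)) h0
  simp [mul_assoc, ← Finset.mul_sum] at h1
  simpa [Matrix.vecMul, dotProduct] using h1

/-- The Gale–Nikaido theorem for nonsingular `P₀`-matrices on open regions. If `f a = f b`, the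
perturbation `G x = f x - f a + ε (x - a)`, which is injective, vanishes at `a`, and the point near
`b` where its length is minimal is another zero of it. -/
theorem HasJacobianOn.injOn_of_isP0Matrix (hX : IsRectangular X) (hXo : IsOpen X)
    (hf : HasJacobianOn f Df X) (hP : ∀ x ∈ X, (Df x).IsP0Matrix)
    (hdet : ∀ x ∈ X, (Df x).det ≠ 0) : Set.InjOn f X := by
  intro a ha b hb hab
  by_contra hne
  have hker : LinearMap.ker (Matrix.toLin' (Df b)) = ⊥ :=
    LinearMap.ker_eq_bot'.2 fun v hv => by
      by_contra hv0
      exact hdet b hb (Matrix.exists_mulVec_eq_zero_iff.1 ⟨v, hv0, by simpa using hv⟩)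
  have hfb := (hf b hb).hasFDerivAt (hXo.mem_nhds hb)
  obtain ⟨C, hC, hbound⟩ := (hfb.isTheta_sub
    (LinearMap.isClosedEmbedding_of_injective hker).isInducing).2.exists_pos
  have hev := (hbound.bound.and (hXo.mem_nhds hb)).and
    (isOpen_ne.mem_nhds (Ne.symm hne))
  obtain ⟨r, hr, hball⟩ := Metric.nhds_basis_closedBall.mem_iff.1 hev
  -- `δ` bounds the perturbation on the ball, while `f - f b` has norm at least
  -- `r / C = (n + 2) * δ` on the sphere.
  obtain ⟨δ, hδ⟩ : ∃ δ, δ = r / C / (n + 2) := ⟨_, rfl⟩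
  obtain ⟨ε, hε⟩ : ∃ ε, ε = δ / (r + ‖b - a‖) := ⟨_, rfl⟩
  have hδ0 : 0 < δ := by rw [hδ]; positivity
  have hε0 : 0 < ε := by rw [hε]; positivity
  have hεδ : ε * (r + ‖b - a‖) = δ := by rw [hε]; field_simp
  have hδr : (n + 2) * δ = r / C := by rw [hδ]; field_simp
  have hinj := hf.injOn_add_of_isP0Matrix hX hP (smul_id_mem_posDiagonal X hε0)
  obtain ⟨d, hd, hqd⟩ := exists_hasJacobianOn_of_mem_posDiagonal (smul_id_mem_posDiagonal X hε0)
  let G : (Fin n → ℝ) → (Fin n → ℝ) := fun x => f x + ε • x - (f a + ε • a)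
  have hG : ∀ x, G x = (f x - f b) + ε • (x - a) := fun x => by
    simp only [G, hab, smul_sub]
    abel
  have hGd : ∀ x ∈ X, HasFDerivAt G (LinearMap.toContinuousLinearMap
      (Matrix.toLin' (Df x + Matrix.diagonal (d x)))) x := fun x hx =>
    (((hf.add hqd) x hx).hasFDerivAt (hXo.mem_nhds hx)).sub_const _
  have hpert : ∀ x ∈ Metric.closedBall b r, ‖ε • (x - a)‖ ≤ δ := fun x hx => by
    rw [norm_smul, Real.norm_of_nonneg hε0.le, ← hεδ]
    refine mul_le_mul_of_nonneg_left ?_ hε0.le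
    calc ‖x - a‖ = ‖(x - b) + (b - a)‖ := by rw [sub_add_sub_cancel]
      _ ≤ ‖x - b‖ + ‖b - a‖ := norm_add_le _ _
      _ ≤ r + ‖b - a‖ := by
        gcongr
        exact mem_closedBall_iff_norm.1 hx
  obtain ⟨y, hy, hmin⟩ := (isCompact_closedBall b r).exists_isMinOn
    (f := fun x => ∑ i, G x i ^ 2) ⟨b, Metric.mem_closedBall_self hr.le⟩ (by
      have hGc : ContinuousOn G (Metric.closedBall b r) := fun x hx =>
        (hGd x (hball hx).1.2).continuousAt.continuousWithinAt
      refine continuousOn_finsetSum _ fun i _ => ?_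
      exact (continuousOn_pi.1 hGc i).pow 2)
  have hyball : y ∈ Metric.ball b r := by
    by_contra hout
    have hyr : ‖y - b‖ = r := le_antisymm (mem_closedBall_iff_norm.1 hy)
      (not_lt.1 fun h => hout (mem_ball_iff_norm.2 h))
    have h₁ : r / C ≤ ‖f y - f b‖ := by
      rw [div_le_iff₀ hC, mul_comm, ← hyr]
      exact (hball hy).1.1
    have h₂ : (n + 1) * δ ≤ ‖G y‖ := by
      have h₃ := norm_sub_le (G y) (ε • (y - a))
      rw [hG, add_sub_cancel_right, ← hG] at h₃
      linarith [hpert y hy]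
    have h₄ : ‖G y‖ ≤ √(∑ i, G y i ^ 2) := by
      refine (pi_norm_le_iff_of_nonneg (Real.sqrt_nonneg _)).2 fun i => Real.abs_le_sqrt ?_
      exact Finset.single_le_sum (f := fun i => G y i ^ 2) (fun i _ => sq_nonneg _)
        (Finset.mem_univ i)
    have h₅ : ((n + 1) * δ) ^ 2 ≤ ∑ i, G y i ^ 2 :=
      (Real.le_sqrt (by positivity) (Finset.sum_nonneg fun i _ => sq_nonneg _)).1 (h₂.trans h₄)
    have h₆ : ∑ i, G b i ^ 2 ≤ n * δ ^ 2 := by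
      have : ∀ i ∈ Finset.univ, G b i ^ 2 ≤ δ ^ 2 := fun i _ => by
        have hb' := hpert b (Metric.mem_closedBall_self hr.le)
        refine sq_le_sq' ?_ ?_ <;>
        · have := abs_le.1 ((norm_le_pi_norm (G b) i).trans
            ((congrArg norm (hG b)).trans_le (by simpa using hb')))
          linarith [this.1, this.2]
      simpa using Finset.sum_le_sum this
    have h₇ : ∑ i, G y i ^ 2 ≤ ∑ i, G b i ^ 2 := hmin (Metric.mem_closedBall_self hr.le)
    have h₈ : 0 < δ ^ 2 := by positivity
    have h₉ : (0 : ℝ) ≤ n := n.cast_nonneg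
    nlinarith [mul_nonneg h₉ h₈.le, mul_nonneg (mul_nonneg h₉ h₉) h₈.le]
  have hyX : y ∈ X := (hball hy).1.2
  have hdety : (Df y + Matrix.diagonal (d y)).det ≠ 0 := by
    have := ((hP y hyX).add_diagonal (hd y hyX)) (Fin n) id Function.injective_id
    exact (by simpa using this : 0 < (Df y + Matrix.diagonal (d y)).det).ne'
  have hGy : G y = 0 := (hGd y hyX).eq_zero_of_isLocalMin_sum_sq hdety
    (hmin.isLocalMin (Filter.mem_of_superset (Metric.isOpen_ball.mem_nhds hyball)
      Metric.ball_subset_closedBall))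
  exact (hball hy).2 (hinj hyX ha (sub_eq_zero.1 hGy))

end Jacobian

/-! ### Injectivity from DSR graphs -/

theorem mainTheorem1 {n : ℕ} (X : Set (Fin n → ℝ)) (hX : IsRectangular X)
    (f : (Fin n → ℝ) → (Fin n → ℝ)) (Df : (Fin n → ℝ) → Matrix (Fin n) (Fin n) ℝ)
    (hf : HasJacobianOn f Df X) :
    ((∀ x ∈ X, ∃ m : ℕ, ∃ G ∈ dsrGraphsOf (Df x) m, G.Nondegenerate ∧ G.NoECycles) →
      (∀ g ∈ fMinus X f, Set.InjOn g X) ∧ Set.InjOn f X) ∧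
    (IsOpen X →
      (∀ x ∈ X, ∃ m : ℕ, ∃ G ∈ dsrGraphsOf (Df x) m, G.WeaklyNondegenerate ∧ G.NoECycles) →
      (∀ g ∈ fMinus X f, Set.InjOn g X) ∧ Set.InjOn f X) := by
  have of_neg : ∀ g : (Fin n → ℝ) → (Fin n → ℝ), Set.InjOn (-g) X → Set.InjOn g X :=
    fun g hg a ha b hb hab => hg ha hb (congrArg Neg.neg hab)
  have hminus : (∀ x ∈ X, (-Df x).IsP0Matrix) → ∀ g ∈ fMinus X f, Set.InjOn g X := by
    rintro hP0 _ ⟨q, hq, rfl⟩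
    refine of_neg _ ?_
    rw [neg_sub, sub_eq_neg_add]
    exact hf.neg.injOn_add_of_isP0Matrix hX hP0 hq
  refine ⟨fun h => ?_, fun hXo h => ?_⟩
  · have hP : ∀ x ∈ X, (-Df x).IsPMatrix := fun x hx => by
      obtain ⟨m, _, ⟨A, B, hAB, rfl⟩, hnd, hG⟩ := h x hx
      rw [← hAB]
      exact hG.isPMatrix hnd
    exact ⟨hminus fun x hx => (hP x hx).isP0Matrix,
      of_neg _ (hf.neg.injOn_of_isPMatrix hX hP)⟩
  · have hP0 : ∀ x ∈ X, (-Df x).IsP0Matrix ∧ (-Df x).det ≠ 0 := fun x hx => by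
      obtain ⟨m, _, ⟨A, B, hAB, rfl⟩, hnd, hG⟩ := h x hx
      rw [← hAB]
      exact ⟨hG.isP0Matrix, (hG.det_pos hnd).ne'⟩
    exact ⟨hminus fun x hx => (hP0 x hx).1,
      of_neg _ (hf.neg.injOn_of_isP0Matrix hX hXo (fun x hx => (hP0 x hx).1)
        fun x hx => (hP0 x hx).2)⟩
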